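/- Let $d\ge 1$, let $(\mathbb S,d_{\mathbb S})$ be a separable metric space and let $\nu$ be a $\sigma$-finite Borel measure on $\mathbb S$. Let $X=\{(u,m_u)\}_{u\in Y}$ be a marked point process, where $Y$ is a point process on $\mathbb R^d$ and the marks $m_u$ are random finite measures on $\mathbb R^d\times\mathbb S$. Assume the null model: $Y$ is a Poisson process with a locally integrable intensity function $\rho_Y$ and, given $Y$, the marks are independent, the mark of a point $u\in Y$ having a distribution $\kappa_u$ that may depend on its location $u$ (but not on the other points of $Y$). Assume that the first moment measure $\mu(C)=\mathbb E\sum_{u\in Y} m_u(C)$ has a finite density $\rho$ with respect to $\mathrm{Leb}\otimes\nu$, and that $\rho>0$ almost everywhere. For measurable $C\subseteq\mathbb R^d\times\mathbb S$ and $D\subseteq(\mathbb R^d\times\mathbb S)^2$ put $$\mu_w(C)=\mathbb E\sum_{u\in Y}\int_C\frac{m_u(dx,ds)}{\rho(x,s)},\qquad \alpha_w^{(2)}(D)=\mathbb E\sum_{u\neq u'\in Y}\int_D\frac{m_u(dx,ds)\,m_{u'}(dy,dt)}{\rho(x,s)\rho(y,t)},$$ and, for $W\subseteq\mathbb R^d$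 measurable with $0<|W|<\infty$ and $r_1,r_2\ge 0$, $$K_w(r_1,r_2;W)=\frac1{|W|}\,\mathbb E\sum_{u\neq u'\in Y}\int\frac{\mathbf 1[x\in W,\ \|x-y\|\le r_1,\ d_{\mathbb S}(s,t)\le r_2]}{\rho(x,s)\rho(y,t)}\,m_u(dx,ds)\,m_{u'}(dy,dt).$$ Then $\alpha_w^{(2)}=\mu_w\otimes\mu_w$, and $\alpha_w^{(2)}$ is stationary: $\alpha_w^{(2)}((A\times S)\times(B\times T))=\alpha_w^{(2)}(((A+h)\times S)\times((B+h)\times T))$ for all measurable $A,B\subseteq\mathbb R^d$, $S,T\subseteq\mathbb S$ and all $h\in\mathbb R^d$. Moreover $K_w(r_1,r_2;W)$ does not depend on $W$ and equals $$K_0(r_1,r_2)=|b(0,r_1)|\;\nu^2\big(\{(s,t)\in\mathbb S^2: d_{\mathbb S}(s,t)\le r_2\}\big),$$ where $b(0,r_1)$ is the ball of radius $r_1$ in $\mathbb R^d$ (an equality in $[0,\infty]$). Let now $\mathbb S$ be the unit sphere of $\mathbb R^d$ with the angle $d_{\mathbb S}(s,t)=\arccos\langle s,t\rangle$ as metric and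 let $\nu$ be surface measure normalised to total mass $1$. Then, for $r_1\ge 0$ and $0\le r_2\le\pi$, $K_0(r_1,r_2)=r_1^2r_2$ if $d=2$ and $K_0(r_1,r_2)=\frac{2\pi}{3}r_1^3(1-\cos r_2)$ if $d=3$. In particular these are the values of $K_w(r_1,r_2;W)$ under the null model when the marks are the measures of oriented fibres, $m_u(A\times T)=\int_{\gamma_u}\mathbf 1[x\in A,\tau(x)\in T]\,\lambda(dx)$, where $\gamma_u$ is an oriented fibre (a simple $C^1$ arc) of finite length with midpoint $u$, unit tangent $\tau$ and length measure $\lambda$. -/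

import Mathlib

open MeasureTheory ProbabilityTheory
open scoped ENNReal NNReal

/-- Euclidean space `ℝ^d`. -/
abbrev Euc (d : ℕ) : Type := EuclideanSpace ℝ (Fin d)

/-- A marked point process `X = {(u_i, m_i) : i < N}` with centre points `u_i` in `ℝ^d` and with
random finite measures `m_i` on `ℝ^d × S` as marks, given by a measurable enumeration: a random
number `N` (possibly infinite) of points, and random variables `point i`, `mark i`, of which only
those with `i < N` belong to the process. -/
structure MarkedProcess (d : ℕ) (S Ω : Type*) [MeasurableSpace S] [MeasurableSpace Ω] where
  N : Ω → ℕ∞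
  point : ℕ → Ω → Euc d
  mark : ℕ → Ω → Measure (Euc d × S)
  measurable_N : Measurable N
  measurable_point : ∀ i, Measurable (point i)
  measurable_mark : ∀ i, Measurable (mark i)
  finite_mark : ∀ i ω, IsFiniteMeasure (mark i ω)

/-- `η` (a random counting measure) is a Poisson process with intensity measure `Λ`: the numbers
of points in sets of finite intensity are Poisson distributed, and the numbers of points in
pairwise disjoint sets are independent. -/
structure IsPoissonProcess {Ω E : Type*} [MeasurableSpace Ω] [TopologicalSpace E]
    [MeasurableSpace E] (P : Measure Ω) (η : Ω → Measure E) (Λ : Measure E) : Prop where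
  locallyFinite : IsLocallyFiniteMeasure Λ
  law : ∀ A : Set E, MeasurableSet A → Λ A < ∞ →
    P.map (fun ω => η ω A) = (poissonMeasure (Λ A).toNNReal).map (fun n : ℕ => (n : ℝ≥0∞))
  indep : ∀ (k : ℕ) (A : Fin k → Set E), (∀ j, MeasurableSet (A j)) →
    Pairwise (fun i j => Disjoint (A i) (A j)) → iIndepFun (fun j ω => η ω (A j)) P

/-- `α(A × S, B × T) = α((A + h) × S, (B + h) × T)` for all `h`. -/
def IsTranslationStationary {d : ℕ} {S : Type*} [MeasurableSpace S]
    (α : Measure ((Euc d × S) × (Euc d × S))) : Prop :=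
  ∀ (h : Euc d) (A B : Set (Euc d)) (U T : Set S), MeasurableSet A → MeasurableSet B →
    MeasurableSet U → MeasurableSet T →
    α ((A ×ˢ U) ×ˢ (B ×ˢ T)) =
      α ((((fun x => x + h) '' A) ×ˢ U) ×ˢ (((fun x => x + h) '' B) ×ˢ T))

/-- The set of all `((x, s), (y, t))` with `x ∈ W`, `‖x - y‖ ≤ r₁` and `d_S(s, t) ≤ r₂`. -/
def closePairs {d : ℕ} {S : Type*} [MetricSpace S] (W : Set (Euc d)) (r₁ r₂ : ℝ) :
    Set ((Euc d × S) × (Euc d × S)) :=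
  {z | z.1.1 ∈ W ∧ ‖z.1.1 - z.2.1‖ ≤ r₁ ∧ dist z.1.2 z.2.2 ≤ r₂}

/-- `K₀(r₁, r₂) = |b(0, r₁)| ν²{(s, t) : d_S(s, t) ≤ r₂}`. -/
noncomputable def nullK (d : ℕ) {S : Type*} [MetricSpace S] [MeasurableSpace S] (ν : Measure S)
    (r₁ r₂ : ℝ) : ℝ≥0∞ :=
  volume (Metric.closedBall (0 : Euc d) r₁) * (ν.prod ν) {p : S × S | dist p.1 p.2 ≤ r₂}

namespace MarkedProcess

variable {d : ℕ} {S Ω : Type*} [MeasurableSpace S] [MeasurableSpace Ω]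

/-- The point process `Y` of centre points, as a random counting measure. -/
noncomputable def centres (X : MarkedProcess d S Ω) (ω : Ω) : Measure (Euc d) :=
  Measure.sum fun i : ℕ => if (i : ℕ∞) < X.N ω then Measure.dirac (X.point i ω) else 0

/-- The random measure `Φ = ∑_{m} m`. -/
noncomputable def total (X : MarkedProcess d S Ω) (ω : Ω) : Measure (Euc d × S) :=
  Measure.sum fun i : ℕ => if (i : ℕ∞) < X.N ω then X.mark i ω else 0

/-- The random measure `∑_{m ≠ m'} m ⊗ m'`, the sum extending over all ordered pairs of distinct
members of the process. -/
noncomputable def pairs (X : MarkedProcess d S Ω) (ω : Ω) :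
    Measure ((Euc d × S) × (Euc d × S)) :=
  Measure.sum fun p : ℕ × ℕ =>
    if p.1 ≠ p.2 ∧ (p.1 : ℕ∞) < X.N ω ∧ (p.2 : ℕ∞) < X.N ω then
      (X.mark p.1 ω).prod (X.mark p.2 ω) else 0

/-- The first moment measure `μ = E Φ`. -/
noncomputable def firstMoment (X : MarkedProcess d S Ω) (P : Measure Ω) : Measure (Euc d × S) :=
  P.bind X.total

/-- `μ` has density `ρ` with respect to Lebesgue measure times `ν`. -/
structure HasDensity (X : MarkedProcess d S Ω) (P : Measure Ω) (ν : Measure S)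
    (ρ : Euc d × S → ℝ≥0) : Prop where
  measurable : Measurable ρ
  eq : X.firstMoment P = ((volume : Measure (Euc d)).prod ν).withDensity (fun z => (ρ z : ℝ≥0∞))

/-- The reweighted first moment measure `μ_w(C) = E ∑_m ∫ 1_C / ρ dm`. -/
noncomputable def firstReweighted (X : MarkedProcess d S Ω) (P : Measure Ω)
    (ρ : Euc d × S → ℝ≥0) : Measure (Euc d × S) :=
  P.bind fun ω => (X.total ω).withDensity fun z => (ρ z : ℝ≥0∞)⁻¹

/-- The reweighted second-order factorial moment measure
`α_w(C) = E ∑_{m ≠ m'} ∫ 1_C((x, s), (y, t)) / (ρ(x, s) ρ(y, t)) m(dx, ds) m'(dy, dt)`. -/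
noncomputable def secondReweighted (X : MarkedProcess d S Ω) (P : Measure Ω)
    (ρ : Euc d × S → ℝ≥0) : Measure ((Euc d × S) × (Euc d × S)) :=
  P.bind fun ω => (X.pairs ω).withDensity fun z => (ρ z.1 : ℝ≥0∞)⁻¹ * (ρ z.2 : ℝ≥0∞)⁻¹

/-- `K_w(r₁, r₂; W) = |W|⁻¹ E ∑_{m ≠ m'} ∫ 1[x ∈ W, ‖x - y‖ ≤ r₁, d_S(s, t) ≤ r₂] /
(ρ(x, s) ρ(y, t)) m(dx, ds) m'(dy, dt)`. -/
noncomputable def reweightedK [MetricSpace S] (X : MarkedProcess d S Ω) (P : Measure Ω)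
    (ρ : Euc d × S → ℝ≥0) (r₁ r₂ : ℝ) (W : Set (Euc d)) : ℝ≥0∞ :=
  (volume W)⁻¹ * ∫⁻ ω, ∫⁻ z in closePairs W r₁ r₂,
    (ρ z.1 : ℝ≥0∞)⁻¹ * (ρ z.2 : ℝ≥0∞)⁻¹ ∂(X.pairs ω) ∂P

/-- Given the centre points, the marks are independent, the mark of a point at `u` having
distribution `κ u`. -/
def IsIndependentMarking (X : MarkedProcess d S Ω) (P : Measure Ω)
    (κ : Kernel (Euc d) (Measure (Euc d × S))) : Prop :=
  ∀ (n : ℕ) (F : Fin n → Set (Measure (Euc d × S))) (G : Set (ℕ∞ × (ℕ → Euc d))),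
    (∀ i, MeasurableSet (F i)) → MeasurableSet G →
    P {ω | ((X.N ω, fun i => X.point i ω) ∈ G ∧ (n : ℕ∞) ≤ X.N ω) ∧ ∀ i, X.mark i ω ∈ F i} =
      ∫⁻ ω in {ω | (X.N ω, fun i => X.point i ω) ∈ G ∧ (n : ℕ∞) ≤ X.N ω},
        ∏ i : Fin n, κ (X.point i ω) (F i) ∂P

/-- The null model: the centre points form a Poisson process with intensity function `ρY` and,
given the centre points, the marks are independent, with distributions `κ u`. -/
structure IsNullModel (X : MarkedProcess d S Ω) (P : Measure Ω) (ρY : Euc d → ℝ≥0)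
    (κ : Kernel (Euc d) (Measure (Euc d × S))) : Prop where
  measurable_intensity : Measurable ρY
  poisson : IsPoissonProcess P X.centres (volume.withDensity fun u => (ρY u : ℝ≥0∞))
  markov : IsMarkovKernel κ
  marking : X.IsIndependentMarking P κ

theorem measurableSet_lt_N (X : MarkedProcess d S Ω) (i : ℕ) :
    MeasurableSet {ω | (i : ℕ∞) < X.N ω} :=
  X.measurable_N (MeasurableSpace.measurableSet_top (s := Set.Ioi (i : ℕ∞)))

theorem measurable_total (X : MarkedProcess d S Ω) : Measurable X.total := by
  refine Measure.measurable_of_measurable_coe _ fun C hC => ?_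
  simp only [total, Measure.sum_apply _ hC]
  refine Measurable.tsum fun i => ?_
  exact (Measure.measurable_coe hC).comp
    (Measurable.ite (X.measurableSet_lt_N i) (X.measurable_mark i) measurable_const)

theorem measurable_pairs (X : MarkedProcess d S Ω) : Measurable X.pairs := by
  refine Measure.measurable_of_measurable_coe _ fun C hC => ?_
  simp only [pairs, Measure.sum_apply _ hC]
  refine Measurable.tsum fun p => ?_
  have hfin := X.finite_mark
  have hprod : Measurable fun ω => (X.mark p.1 ω).prod (X.mark p.2 ω) := by
    have hrect : ∀ A B : Set (Euc d × S), MeasurableSet A → MeasurableSet B →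
        Measurable fun ω => ((X.mark p.1 ω).prod (X.mark p.2 ω)) (A ×ˢ B) := by
      intro A B hA hB
      simp only [Measure.prod_prod]
      exact ((Measure.measurable_coe hA).comp (X.measurable_mark p.1)).mul
        ((Measure.measurable_coe hB).comp (X.measurable_mark p.2))
    refine Measurable.measure_of_isPiSystem generateFrom_prod.symm isPiSystem_prod ?_ ?_
    · rintro _ ⟨A, hA, B, hB, rfl⟩
      exact hrect A B hA hB
    · simpa using hrect Set.univ Set.univ .univ .univ
  refine (Measure.measurable_coe hC).comp (Measurable.ite ?_ hprod measurable_const)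
  exact (MeasurableSet.const _).inter
    ((X.measurableSet_lt_N _).inter (X.measurableSet_lt_N _))

theorem firstReweighted_apply (X : MarkedProcess d S Ω) (P : Measure Ω) {ρ : Euc d × S → ℝ≥0}
    (hρ : Measurable ρ) {C : Set (Euc d × S)} (hC : MeasurableSet C) :
    X.firstReweighted P ρ C = ∫⁻ ω, ∫⁻ z in C, (ρ z : ℝ≥0∞)⁻¹ ∂(X.total ω) ∂P := by
  have hm : Measurable fun ω => (X.total ω).withDensity fun z => (ρ z : ℝ≥0∞)⁻¹ := by
    refine Measure.measurable_of_measurable_coe _ fun D hD => ?_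
    simp only [withDensity_apply _ hD, ← lintegral_indicator hD]
    exact (Measure.measurable_lintegral (by fun_prop (disch := exact hD))).comp X.measurable_total
  simp only [firstReweighted, Measure.bind_apply hC hm.aemeasurable, withDensity_apply _ hC]

theorem secondReweighted_apply (X : MarkedProcess d S Ω) (P : Measure Ω) {ρ : Euc d × S → ℝ≥0}
    (hρ : Measurable ρ) {C : Set ((Euc d × S) × (Euc d × S))} (hC : MeasurableSet C) :
    X.secondReweighted P ρ C =
      ∫⁻ ω, ∫⁻ z in C, (ρ z.1 : ℝ≥0∞)⁻¹ * (ρ z.2 : ℝ≥0∞)⁻¹ ∂(X.pairs ω) ∂P := by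
  have hm : Measurable fun ω =>
      (X.pairs ω).withDensity fun z => (ρ z.1 : ℝ≥0∞)⁻¹ * (ρ z.2 : ℝ≥0∞)⁻¹ := by
    refine Measure.measurable_of_measurable_coe _ fun D hD => ?_
    simp only [withDensity_apply _ hD, ← lintegral_indicator hD]
    exact (Measure.measurable_lintegral (by fun_prop (disch := exact hD))).comp X.measurable_pairs
  simp only [secondReweighted, Measure.bind_apply hC hm.aemeasurable, withDensity_apply _ hC]

theorem reweightedK_eq [MetricSpace S] [SecondCountableTopology S] [BorelSpace S]
    (X : MarkedProcess d S Ω) (P : Measure Ω) {ρ : Euc d × S → ℝ≥0} (hρ : Measurable ρ)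
    (r₁ r₂ : ℝ) {W : Set (Euc d)} (hW : MeasurableSet W) :
    X.reweightedK P ρ r₁ r₂ W =
      (volume W)⁻¹ * X.secondReweighted P ρ (closePairs W r₁ r₂) := by
  have hC : MeasurableSet (closePairs (S := S) W r₁ r₂) := by
    refine (measurable_fst.fst hW).inter (MeasurableSet.inter ?_ ?_)
    · exact measurableSet_le (measurable_fst.fst.sub measurable_snd.fst).norm measurable_const
    · exact measurableSet_le (measurable_fst.snd.dist measurable_snd.snd) measurable_const
  rw [X.secondReweighted_apply P hρ hC, reweightedK]

end MarkedProcess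

/-- The unit vectors of `ℝ^d`, with the angle `arccos ⟨s, t⟩` as the distance. -/
structure Direction (d : ℕ) where
  vec : Metric.sphere (0 : Euc d) 1

namespace Direction

variable {d : ℕ}

theorem norm_vec (s : Direction d) : ‖(s.vec : Euc d)‖ = 1 := by
  simp

theorem ext_vec {s t : Direction d} (h : (s.vec : Euc d) = t.vec) : s = t := by
  cases s; cases t; congr; exact Subtype.ext h

theorem angle_eq (s t : Direction d) :
    Real.arccos (inner ℝ (s.vec : Euc d) t.vec) =
      InnerProductGeometry.angle (s.vec : Euc d) t.vec := by
  simp [InnerProductGeometry.angle]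

noncomputable instance : MetricSpace (Direction d) where
  dist s t := Real.arccos (inner ℝ (s.vec : Euc d) t.vec)
  dist_self s := by simp
  dist_comm s t := by simp only [real_inner_comm]
  dist_triangle s t u := by
    simp only [angle_eq]
    exact InnerProductGeometry.angle_le_angle_add_angle _ _ _
  eq_of_dist_eq_zero {s t} h := by
    refine ext_vec ?_
    have h1 : 1 ≤ inner ℝ (s.vec : Euc d) t.vec := Real.arccos_eq_zero.1 h
    have h2 := real_inner_le_norm (s.vec : Euc d) t.vec
    rw [norm_vec, norm_vec, mul_one] at h2
    exact (inner_eq_one_iff_of_norm_eq_one (norm_vec s) (norm_vec t)).1 (le_antisymm h2 h1)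

theorem dist_def (s t : Direction d) :
    dist s t = Real.arccos (inner ℝ (s.vec : Euc d) t.vec) := rfl

theorem continuous_mk : Continuous (Direction.mk : Metric.sphere (0 : Euc d) 1 → Direction d) := by
  refine continuous_iff_continuousAt.2 fun x => tendsto_iff_dist_tendsto_zero.2 ?_
  have h : Continuous fun y : Metric.sphere (0 : Euc d) 1 => dist (mk y) (mk x) := by
    simp only [dist_def]
    exact Real.continuous_arccos.comp (by fun_prop)
  simpa using h.tendsto x

theorem continuous_vec : Continuous (Direction.vec : Direction d → Metric.sphere (0 : Euc d) 1) := by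
  have h : Continuous (Direction.mk : Metric.sphere (0 : Euc d) 1 → Direction d) := continuous_mk
  have hb : Function.Bijective (Direction.mk : Metric.sphere (0 : Euc d) 1 → Direction d) :=
    ⟨fun a b hab => by injection hab, fun s => ⟨s.vec, rfl⟩⟩
  exact Continuous.continuous_symm_of_equiv_compact_to_t2
    (f := (⟨Direction.mk, Direction.vec, fun _ => rfl, fun _ => rfl⟩ :
      Metric.sphere (0 : Euc d) 1 ≃ Direction d)) h

instance : SecondCountableTopology (Direction d) :=
  (Topology.IsEmbedding.of_comp continuous_vec continuous_mk
    (by exact Topology.IsEmbedding.id)).secondCountableTopology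

noncomputable instance : MeasurableSpace (Direction d) := borel _

instance : BorelSpace (Direction d) := ⟨rfl⟩

/-- Surface measure on the unit sphere, normalised to total mass one. -/
noncomputable def uniform (d : ℕ) : Measure (Direction d) :=
  ((volume : Measure (Euc d)).toSphere Set.univ)⁻¹ •
    (volume : Measure (Euc d)).toSphere.map Direction.mk

end Direction

/-- `m` is the measure `m(A × T) = ∫_γ 1[x ∈ A, τ(x) ∈ T] λ(dx)` of an oriented fibre of
finite length with midpoint `u`, where `τ` is the unit tangent and `λ` the length measure. The
fibre is a continuously differentiable (in particular, it may be any smooth) simple arc, written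
in its arc length parametrisation. -/
def IsOrientedFibre {d : ℕ} (u : Euc d) (m : Measure (Euc d × Direction d)) : Prop :=
  ∃ (L : ℝ) (γ : ℝ → Euc d) (τ : ℝ → Direction d), 0 < L ∧ γ 0 = u ∧
    ContDiffOn ℝ 1 γ (Set.Icc (-L / 2) (L / 2)) ∧ Set.InjOn γ (Set.Icc (-L / 2) (L / 2)) ∧
    (∀ r ∈ Set.Icc (-L / 2) (L / 2),
      HasDerivWithinAt γ ((τ r).vec : Euc d) (Set.Icc (-L / 2) (L / 2)) r) ∧
    m = (volume.restrict (Set.Icc (-L / 2) (L / 2))).map fun r => (γ r, τ r)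

/-- Almost surely, all marks are the measures of oriented fibres with midpoints at the centre
points. -/
def MarkedProcess.HasOrientedFibreMarks {d : ℕ} {Ω : Type*} [MeasurableSpace Ω]
    (X : MarkedProcess d (Direction d) Ω) (P : Measure Ω) : Prop :=
  ∀ᵐ ω ∂P, ∀ i : ℕ, (i : ℕ∞) < X.N ω → IsOrientedFibre (X.point i ω) (X.mark i ω)

/-!
A Poisson process with intensity measure `Λ` has second factorial moment measure `Λ ⊗ Λ`. On a
rectangle `A × B` the number of pairs of distinct points is `η(A) η(B) - η(A ∩ B)`; cutting `A` and
`B` along `A ∩ B` and using independence and the Poisson second moment gives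
`E η(A) η(B) = Λ(A) Λ(B) + Λ(A ∩ B)` (`IsPoissonProcess.lintegral_apply_mul`), and the term
`Λ(A ∩ B)` is exactly the diagonal contribution (`MarkedProcess.pairIntensity_eq`).

Given the centre points, distinct marks are independent with laws `κ u` and `κ u'`. Hence, with
`K(u)` the mean measure of `κ u`, Campbell's formula (`lintegral_total`, `lintegral_pairs`)
expresses the moments of the marks by integrals of `K(u)` against `Λ` and of `K(u) ⊗ K(u')` against
`Λ ⊗ Λ`. The latter factorise (`MarkedProcess.IsNullModel.lintegral_pairs`), so that
`α_w = μ_w ⊗ μ_w` on rectangles and then everywhere. Dividing the first moment measure by its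
density leaves `μ_w = Leb ⊗ ν`. Stationarity is then translation invariance of Lebesgue measure,
and slicing the set of close pairs along its first point (`prod_closePairs`) gives
`α_w(closePairs W r₁ r₂) = |W| K₀(r₁, r₂)`.

For the unit sphere, reflections show that all angular balls of radius `r` have the same measure,
namely the proportion of the unit ball taken up by the sector of half-angle `r` around the first
axis. Polar coordinates in the plane give the sector's area `r` for `d = 2`. For `d = 3` the sector
is obtained by rotating a planar half-sector about its axis, so its volume is `2π` times the
integral of the distance to the axis, `∫₀¹ R² dR ∫₀ʳ sin θ dθ = (1 - cos r) / 3`. For fibre marks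
the formulas are these values of `K₀` inserted in the general identity.
-/

/-! ### Moments of the Poisson distribution -/

/-- The Chen–Stein identity `E n f(n) = r E f(n + 1)` for a Poisson variable of mean `r`. -/
theorem lintegral_natCast_mul_poissonMeasure (r : ℝ≥0) (f : ℕ → ℝ≥0∞) :
    ∫⁻ n : ℕ, (n : ℝ≥0∞) * f n ∂poissonMeasure r =
      r * ∫⁻ n : ℕ, f (n + 1) ∂poissonMeasure r := by
  simp only [poissonMeasure, lintegral_sum_measure, lintegral_smul_measure, lintegral_dirac,
    smul_eq_mul]
  rw [tsum_eq_zero_add' ENNReal.summable, ← ENNReal.tsum_mul_left]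
  simp only [Nat.cast_zero, zero_mul, mul_zero, zero_add]
  refine tsum_congr fun n => ?_
  rw [← mul_assoc, ← mul_assoc]
  congr 1
  rw [← ENNReal.ofReal_natCast, ← ENNReal.ofReal_coe_nnreal (p := r),
    ← ENNReal.ofReal_mul (by positivity), ← ENNReal.ofReal_mul (by positivity)]
  congr 1
  rw [Nat.factorial_succ]
  push_cast
  field_simp
  ring

theorem lintegral_natCast_poissonMeasure (r : ℝ≥0) :
    ∫⁻ n : ℕ, (n : ℝ≥0∞) ∂poissonMeasure r = r := by
  simpa using lintegral_natCast_mul_poissonMeasure r fun _ => 1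

theorem lintegral_natCast_sq_poissonMeasure (r : ℝ≥0) :
    ∫⁻ n : ℕ, (n : ℝ≥0∞) * n ∂poissonMeasure r = r * (r + 1) := by
  rw [lintegral_natCast_mul_poissonMeasure]
  push_cast
  rw [lintegral_add_left (by fun_prop), lintegral_natCast_poissonMeasure]
  simp

/-! ### Measures determined by sets of finite measure -/

namespace MeasureTheory.Measure

variable {α β : Type*} [MeasurableSpace α] [MeasurableSpace β]

theorem generateFrom_finite_measure (μ : Measure α) [SigmaFinite μ] :
    MeasurableSpace.generateFrom {s | MeasurableSet s ∧ μ s < ∞} = ‹MeasurableSpace α› := by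
  refine le_antisymm (MeasurableSpace.generateFrom_le fun s hs => hs.1) fun s hs => ?_
  rw [← Set.inter_univ s, ← iUnion_spanningSets μ, Set.inter_iUnion]
  refine @MeasurableSet.iUnion _ _ (_) _ _ fun n =>
    MeasurableSpace.measurableSet_generateFrom ⟨hs.inter (measurableSet_spanningSets μ n), ?_⟩
  exact (measure_mono Set.inter_subset_right).trans_lt (measure_spanningSets_lt_top μ n)

theorem isPiSystem_finite_measure (μ : Measure α) :
    IsPiSystem {s | MeasurableSet s ∧ μ s < ∞} := fun _ hs _ ht _ =>
  ⟨hs.1.inter ht.1, (measure_mono Set.inter_subset_left).trans_lt hs.2⟩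

/-- The spanning sets of a `σ`-finite measure, within the measurable sets of finite measure. -/
noncomputable def finiteSpanningSetsInFinite (μ : Measure α) [SigmaFinite μ] :
    μ.FiniteSpanningSetsIn {s | MeasurableSet s ∧ μ s < ∞} where
  set := spanningSets μ
  set_mem n := ⟨measurableSet_spanningSets μ n, measure_spanningSets_lt_top μ n⟩
  finite := measure_spanningSets_lt_top μ
  spanning := iUnion_spanningSets μ

theorem ext_of_finite_measure {μ ν : Measure α} [SigmaFinite μ]
    (h : ∀ s, MeasurableSet s → μ s < ∞ → μ s = ν s) : μ = ν :=
  (finiteSpanningSetsInFinite μ).ext (generateFrom_finite_measure μ).symm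
    (isPiSystem_finite_measure μ) fun s hs => h s hs.1 hs.2

theorem prod_eq_of_finite_measure {μ : Measure α} {ν : Measure β} [SigmaFinite μ] [SigmaFinite ν]
    {π : Measure (α × β)} (h : ∀ s t, MeasurableSet s → μ s < ∞ → MeasurableSet t → ν t < ∞ →
      π (s ×ˢ t) = μ s * ν t) : μ.prod ν = π :=
  prod_eq_generateFrom (generateFrom_finite_measure μ) (generateFrom_finite_measure ν)
    (isPiSystem_finite_measure μ) (isPiSystem_finite_measure ν) (finiteSpanningSetsInFinite μ)
    (finiteSpanningSetsInFinite ν) fun s hs t ht => h s t hs.1 hs.2 ht.1 ht.2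

end MeasureTheory.Measure

/-! ### Second moments of a Poisson process -/

namespace IsPoissonProcess

variable {Ω E : Type*} [MeasurableSpace Ω] [TopologicalSpace E] [MeasurableSpace E]
  {P : Measure Ω} {η : Ω → Measure E} {Λ : Measure E} {A B : Set E}

theorem lintegral_apply_comp (h : IsPoissonProcess P η Λ) (hη : Measurable η)
    (hA : MeasurableSet A) (hΛ : Λ A < ∞) {f : ℝ≥0∞ → ℝ≥0∞} (hf : Measurable f) :
    ∫⁻ ω, f (η ω A) ∂P = ∫⁻ n : ℕ, f n ∂poissonMeasure (Λ A).toNNReal := by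
  have hm : Measurable fun ω => η ω A := (Measure.measurable_coe hA).comp hη
  rw [← lintegral_map hf hm, h.law A hA hΛ, lintegral_map hf (by fun_prop)]

theorem lintegral_apply (h : IsPoissonProcess P η Λ) (hη : Measurable η)
    (hA : MeasurableSet A) (hΛ : Λ A < ∞) : ∫⁻ ω, η ω A ∂P = Λ A := by
  have := h.lintegral_apply_comp hη hA hΛ (f := fun x => x) measurable_id
  rwa [lintegral_natCast_poissonMeasure, ENNReal.coe_toNNReal hΛ.ne] at this

theorem lintegral_apply_mul_self (h : IsPoissonProcess P η Λ) (hη : Measurable η)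
    (hA : MeasurableSet A) (hΛ : Λ A < ∞) :
    ∫⁻ ω, η ω A * η ω A ∂P = Λ A * Λ A + Λ A := by
  rw [h.lintegral_apply_comp hη hA hΛ (f := fun x => x * x) (by fun_prop),
    lintegral_natCast_sq_poissonMeasure, ENNReal.coe_toNNReal hΛ.ne, mul_add, mul_one]

theorem lintegral_apply_mul_of_disjoint (h : IsPoissonProcess P η Λ) (hη : Measurable η)
    (hA : MeasurableSet A) (hΛA : Λ A < ∞) (hB : MeasurableSet B) (hΛB : Λ B < ∞)
    (hAB : Disjoint A B) : ∫⁻ ω, η ω A * η ω B ∂P = Λ A * Λ B := by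
  have hind : IndepFun (fun ω => η ω A) (fun ω => η ω B) P := by
    have := h.indep 2 ![A, B] (by simp [Fin.forall_fin_two, hA, hB]) ?_
    · simpa using this.indepFun (show (0 : Fin 2) ≠ 1 by simp)
    · intro i j hij
      fin_cases i <;> fin_cases j <;> simp_all [disjoint_comm]
  have hm := lintegral_mul_eq_lintegral_mul_lintegral_of_indepFun
    ((Measure.measurable_coe hA).comp hη) ((Measure.measurable_coe hB).comp hη) hind
  simp only [Pi.mul_apply, Function.comp_apply] at hm
  rw [hm, h.lintegral_apply hη hA hΛA, h.lintegral_apply hη hB hΛB]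

/-- The second moments of a Poisson process: the two sets are cut along their intersection, so
that independence applies to disjoint pieces and the Poisson variance to the common piece. -/
theorem lintegral_apply_mul (h : IsPoissonProcess P η Λ) (hη : Measurable η)
    (hA : MeasurableSet A) (hΛA : Λ A < ∞) (hB : MeasurableSet B) (hΛB : Λ B < ∞) :
    ∫⁻ ω, η ω A * η ω B ∂P = Λ A * Λ B + Λ (A ∩ B) := by
  have hI := hA.inter hB
  have hA' := hA.diff hB
  have hB' := hB.diff hA
  have fI : Λ (A ∩ B) < ∞ := (measure_mono Set.inter_subset_left).trans_lt hΛA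
  have fA' : Λ (A \ B) < ∞ := (measure_mono Set.sdiff_subset).trans_lt hΛA
  have fB' : Λ (B \ A) < ∞ := (measure_mono Set.sdiff_subset).trans_lt hΛB
  have m : ∀ {C}, MeasurableSet C → Measurable fun ω => η ω C :=
    fun hC => (Measure.measurable_coe hC).comp hη
  have sA : ∀ μ : Measure E, μ A = μ (A ∩ B) + μ (A \ B) :=
    fun μ => (measure_inter_add_sdiff A hB).symm
  have sB : ∀ μ : Measure E, μ B = μ (A ∩ B) + μ (B \ A) := fun μ => by
    rw [Set.inter_comm]; exact (measure_inter_add_sdiff B hA).symm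
  have d1 : Disjoint (A ∩ B) (B \ A) :=
    Set.disjoint_left.2 fun x hx hx' => hx'.2 hx.1
  have d2 : Disjoint (A \ B) (A ∩ B) :=
    Set.disjoint_left.2 fun x hx hx' => hx.2 hx'.2
  have d3 : Disjoint (A \ B) (B \ A) :=
    Set.disjoint_left.2 fun x hx hx' => hx.2 hx'.1
  have expand : ∀ ω, η ω A * η ω B =
      (η ω (A ∩ B) * η ω (A ∩ B) + η ω (A ∩ B) * η ω (B \ A)) +
        (η ω (A \ B) * η ω (A ∩ B) + η ω (A \ B) * η ω (B \ A)) := fun ω => by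
    rw [sA (η ω), sB (η ω)]; ring
  simp only [expand]
  have mm : ∀ {C D}, MeasurableSet C → MeasurableSet D → Measurable fun ω => η ω C * η ω D :=
    fun hC hD => (m hC).mul (m hD)
  have mp : Measurable fun ω => η ω (A ∩ B) * η ω (A ∩ B) + η ω (A ∩ B) * η ω (B \ A) :=
    (mm hI hI).add (mm hI hB')
  rw [lintegral_add_left mp, lintegral_add_left (mm hI hI), lintegral_add_left (mm hA' hI),
    h.lintegral_apply_mul_self hη hI fI, h.lintegral_apply_mul_of_disjoint hη hI fI hB' fB' d1,
    h.lintegral_apply_mul_of_disjoint hη hA' fA' hI fI d2,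
    h.lintegral_apply_mul_of_disjoint hη hA' fA' hB' fB' d3, sA Λ, sB Λ]
  ring

end IsPoissonProcess

/-! ### Moment measures of the centre points -/

namespace MarkedProcess

variable {d : ℕ} {S Ω : Type*} [MeasurableSpace S] [MeasurableSpace Ω]

/-- The first moment measure `E ∑_{u} 1[u ∈ ·]` of the centre points, as a sum over the indices of
the enumeration. -/
noncomputable def pointIntensity (X : MarkedProcess d S Ω) (P : Measure Ω) : Measure (Euc d) :=
  Measure.sum fun i : ℕ => (P.restrict {ω | (i : ℕ∞) < X.N ω}).map (X.point i)

/-- The second factorial moment measure `E ∑_{u ≠ u'} 1[(u, u') ∈ ·]` of the centre points; the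
sum extends over pairs of distinct indices, so two members of the enumeration at the same location
count as distinct. -/
noncomputable def pairIntensity (X : MarkedProcess d S Ω) (P : Measure Ω) :
    Measure (Euc d × Euc d) :=
  Measure.sum fun p : ℕ × ℕ => if p.1 ≠ p.2 then
    (P.restrict {ω | (p.1 : ℕ∞) < X.N ω ∧ (p.2 : ℕ∞) < X.N ω}).map
      fun ω => (X.point p.1 ω, X.point p.2 ω) else 0

theorem measurable_centres (X : MarkedProcess d S Ω) : Measurable X.centres := by
  refine Measure.measurable_of_measurable_coe _ fun C hC => ?_
  simp only [centres, Measure.sum_apply _ hC]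
  refine Measurable.tsum fun i => ?_
  exact (Measure.measurable_coe hC).comp (Measurable.ite (X.measurableSet_lt_N i)
    (Measure.measurable_dirac.comp (X.measurable_point i)) measurable_const)

theorem centres_apply (X : MarkedProcess d S Ω) {A : Set (Euc d)} (hA : MeasurableSet A) (ω : Ω) :
    X.centres ω A =
      ∑' i : ℕ, ({ω | (i : ℕ∞) < X.N ω} ∩ X.point i ⁻¹' A).indicator (1 : Ω → ℝ≥0∞) ω := by
  classical
  rw [centres, Measure.sum_apply _ hA]
  refine tsum_congr fun i => ?_
  by_cases h1 : (i : ℕ∞) < X.N ω <;> by_cases h2 : X.point i ω ∈ A <;>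
    simp [h1, h2, Set.indicator, Measure.dirac_apply' _ hA]

theorem pointIntensity_apply (X : MarkedProcess d S Ω) (P : Measure Ω) {A : Set (Euc d)}
    (hA : MeasurableSet A) :
    X.pointIntensity P A = ∑' i : ℕ, P ({ω | (i : ℕ∞) < X.N ω} ∩ X.point i ⁻¹' A) := by
  rw [pointIntensity, Measure.sum_apply _ hA]
  refine tsum_congr fun i => ?_
  rw [Measure.map_apply (X.measurable_point i) hA,
    Measure.restrict_apply (X.measurable_point i hA), Set.inter_comm]

theorem measurableSet_lt_N_point (X : MarkedProcess d S Ω) {A : Set (Euc d)}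
    (hA : MeasurableSet A) (i : ℕ) :
    MeasurableSet ({ω | (i : ℕ∞) < X.N ω} ∩ X.point i ⁻¹' A) :=
  (X.measurableSet_lt_N i).inter (X.measurable_point i hA)

theorem measurableSet_lt_N_pair (X : MarkedProcess d S Ω) (i j : ℕ) :
    MeasurableSet {ω | (i : ℕ∞) < X.N ω ∧ (j : ℕ∞) < X.N ω} :=
  (X.measurableSet_lt_N i).inter (X.measurableSet_lt_N j)

theorem lintegral_centres (X : MarkedProcess d S Ω) (P : Measure Ω) {A : Set (Euc d)}
    (hA : MeasurableSet A) : ∫⁻ ω, X.centres ω A ∂P = X.pointIntensity P A := by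
  simp only [X.centres_apply hA, X.pointIntensity_apply P hA]
  rw [lintegral_tsum fun i =>
    (measurable_one.indicator (X.measurableSet_lt_N_point hA i)).aemeasurable]
  exact tsum_congr fun i => lintegral_indicator_one (X.measurableSet_lt_N_point hA i)

theorem pairIntensity_prod (X : MarkedProcess d S Ω) (P : Measure Ω) {A B : Set (Euc d)}
    (hA : MeasurableSet A) (hB : MeasurableSet B) :
    X.pairIntensity P (A ×ˢ B) = ∑' i : ℕ, ∑' j : ℕ, if i ≠ j then
      P (({ω | (i : ℕ∞) < X.N ω} ∩ X.point i ⁻¹' A) ∩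
        ({ω | (j : ℕ∞) < X.N ω} ∩ X.point j ⁻¹' B)) else 0 := by
  rw [pairIntensity, Measure.sum_apply _ (hA.prod hB), ← ENNReal.tsum_prod]
  refine tsum_congr fun ⟨i, j⟩ => ?_
  by_cases hij : i ≠ j
  · have hm : Measurable fun ω => (X.point i ω, X.point j ω) :=
      (X.measurable_point i).prodMk (X.measurable_point j)
    simp only [if_pos hij]
    rw [Measure.map_apply hm (hA.prod hB), Measure.restrict_apply (hm (hA.prod hB))]
    congr 1
    ext ω
    simp only [Set.mem_inter_iff, Set.mem_preimage, Set.mem_prod, Set.mem_ofPred_eq]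
    tauto
  · simp [hij]

/-- Ordered pairs of points, counted with the diagonal, split into pairs of distinct members and
the diagonal. -/
theorem lintegral_centres_mul (X : MarkedProcess d S Ω) (P : Measure Ω) {A B : Set (Euc d)}
    (hA : MeasurableSet A) (hB : MeasurableSet B) :
    ∫⁻ ω, X.centres ω A * X.centres ω B ∂P =
      X.pairIntensity P (A ×ˢ B) + X.pointIntensity P (A ∩ B) := by
  rw [X.pairIntensity_prod P hA hB, X.pointIntensity_apply P (hA.inter hB), ← ENNReal.tsum_add]
  simp only [X.centres_apply hA, X.centres_apply hB, ← ENNReal.tsum_mul_right]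
  have hm : ∀ i j : ℕ, Measurable fun ω =>
      ({ω | (i : ℕ∞) < X.N ω} ∩ X.point i ⁻¹' A).indicator (1 : Ω → ℝ≥0∞) ω *
        ({ω | (j : ℕ∞) < X.N ω} ∩ X.point j ⁻¹' B).indicator (1 : Ω → ℝ≥0∞) ω := fun i j =>
    (measurable_one.indicator (X.measurableSet_lt_N_point hA i)).mul
      (measurable_one.indicator (X.measurableSet_lt_N_point hB j))
  simp only [← ENNReal.tsum_mul_left]
  rw [lintegral_tsum fun i => (Measurable.tsum fun j => hm i j).aemeasurable]
  refine tsum_congr fun i => ?_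
  rw [lintegral_tsum fun j => (hm i j).aemeasurable]
  have hterm : ∀ j : ℕ, ∫⁻ ω, ({ω | (i : ℕ∞) < X.N ω} ∩ X.point i ⁻¹' A).indicator (1 : Ω → ℝ≥0∞) ω *
        ({ω | (j : ℕ∞) < X.N ω} ∩ X.point j ⁻¹' B).indicator (1 : Ω → ℝ≥0∞) ω ∂P =
      P (({ω | (i : ℕ∞) < X.N ω} ∩ X.point i ⁻¹' A) ∩
        ({ω | (j : ℕ∞) < X.N ω} ∩ X.point j ⁻¹' B)) := fun j => by
    rw [← lintegral_indicator_one
      ((X.measurableSet_lt_N_point hA i).inter (X.measurableSet_lt_N_point hB j))]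
    simp only [Set.inter_indicator_one, Pi.mul_apply]
  simp only [hterm]
  have hdiag : P ({ω | (i : ℕ∞) < X.N ω} ∩ X.point i ⁻¹' (A ∩ B)) =
      ∑' j : ℕ, if j = i then P (({ω | (i : ℕ∞) < X.N ω} ∩ X.point i ⁻¹' A) ∩
        ({ω | (j : ℕ∞) < X.N ω} ∩ X.point j ⁻¹' B)) else 0 := by
    rw [tsum_eq_single i fun j hj => if_neg hj, if_pos rfl, Set.preimage_inter,
      ← Set.inter_inter_distrib_left]
  rw [hdiag, ← ENNReal.tsum_add]
  refine tsum_congr fun j => ?_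
  by_cases hij : i = j
  · simp [hij]
  · simp [hij, Ne.symm hij]

section Poisson

variable {X : MarkedProcess d S Ω} {P : Measure Ω} {Λ : Measure (Euc d)}

theorem pointIntensity_eq (h : IsPoissonProcess P X.centres Λ) : X.pointIntensity P = Λ := by
  have := h.locallyFinite
  refine (Measure.ext_of_finite_measure fun A hA hΛ => ?_).symm
  rw [← X.lintegral_centres P hA, h.lintegral_apply X.measurable_centres hA hΛ]

/-- The second factorial moment measure of a Poisson process is the square of its intensity
measure. -/
theorem pairIntensity_eq (h : IsPoissonProcess P X.centres Λ) :
    X.pairIntensity P = Λ.prod Λ := by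
  have := h.locallyFinite
  refine (Measure.prod_eq_of_finite_measure fun A B hA fA hB fB => ?_).symm
  have h2 := h.lintegral_apply_mul X.measurable_centres hA fA hB fB
  rw [X.lintegral_centres_mul P hA hB, pointIntensity_eq h] at h2
  -- The diagonal term `Λ (A ∩ B)` is finite and cancels.
  exact (ENNReal.add_left_inj
    ((measure_mono Set.inter_subset_left).trans_lt fA).ne).1 h2

end Poisson

end MarkedProcess

namespace MarkedProcess

variable {d : ℕ} {S Ω : Type*} [MeasurableSpace S] [MeasurableSpace Ω]

/-! ### Independent marking and Campbell's formulas -/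

section Marking

variable {X : MarkedProcess d S Ω} {P : Measure Ω} {κ : Kernel (Euc d) (Measure (Euc d × S))}

theorem natCast_succ_le_iff (i : ℕ) (N : ℕ∞) : ((i + 1 : ℕ) : ℕ∞) ≤ N ↔ (i : ℕ∞) < N := by
  cases N using ENat.recTopCoe with
  | top => simp
  | coe n => norm_cast

theorem natCast_max_succ_le_iff (i j : ℕ) (N : ℕ∞) :
    ((max i j + 1 : ℕ) : ℕ∞) ≤ N ↔ (i : ℕ∞) < N ∧ (j : ℕ∞) < N := by
  rw [natCast_succ_le_iff]
  cases N using ENat.recTopCoe with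
  | top => simp
  | coe n => norm_cast; exact max_lt_iff

/-- A statement about the single mark `i` is one about the first `i + 1` marks that leaves the
others unrestricted; their kernels contribute factors `1`. -/
theorem IsIndependentMarking.measure_mark_mem (h : X.IsIndependentMarking P κ) [IsMarkovKernel κ]
    (i : ℕ) {F : Set (Measure (Euc d × S))} (hF : MeasurableSet F) :
    P ({ω | (i : ℕ∞) < X.N ω} ∩ X.mark i ⁻¹' F) =
      ∫⁻ ω in {ω | (i : ℕ∞) < X.N ω}, κ (X.point i ω) F ∂P := by
  have hi : i < i + 1 := Nat.lt_succ_self i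
  have := h (i + 1) (fun k => if (k : ℕ) = i then F else Set.univ) Set.univ
    (fun k => by split_ifs <;> simp [hF]) .univ
  simp only [Set.mem_univ, true_and, natCast_succ_le_iff] at this
  convert this using 1
  · congr 1
    ext ω
    simp only [Set.mem_inter_iff, Set.mem_preimage, Set.mem_ofPred_eq]
    refine and_congr_right fun _ => ⟨fun hm k => ?_, fun hm => ?_⟩
    · split_ifs with hk
      · rwa [hk]
      · trivial
    · simpa using hm ⟨i, hi⟩
  · refine lintegral_congr fun ω => ?_
    rw [Finset.prod_eq_single (⟨i, hi⟩ : Fin (i + 1))]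
    · simp
    · intro k _ hk
      have : (k : ℕ) ≠ i := fun hk' => hk (Fin.ext hk')
      simp [this]
    · simp

theorem IsIndependentMarking.measure_mark_mem_pair (h : X.IsIndependentMarking P κ)
    [IsMarkovKernel κ] {i j : ℕ} (hij : i ≠ j) {F G : Set (Measure (Euc d × S))}
    (hF : MeasurableSet F) (hG : MeasurableSet G) :
    P ({ω | (i : ℕ∞) < X.N ω ∧ (j : ℕ∞) < X.N ω} ∩
        (fun ω => (X.mark i ω, X.mark j ω)) ⁻¹' (F ×ˢ G)) =
      ∫⁻ ω in {ω | (i : ℕ∞) < X.N ω ∧ (j : ℕ∞) < X.N ω},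
        κ (X.point i ω) F * κ (X.point j ω) G ∂P := by
  have hi : i < max i j + 1 := Nat.lt_succ_of_le (le_max_left i j)
  have hj : j < max i j + 1 := Nat.lt_succ_of_le (le_max_right i j)
  have := h (max i j + 1) (fun k => if (k : ℕ) = i then F else if (k : ℕ) = j then G else Set.univ)
    Set.univ (fun k => by split_ifs <;> simp [hF, hG]) .univ
  simp only [Set.mem_univ, true_and, natCast_max_succ_le_iff] at this
  convert this using 1
  · congr 1
    ext ω
    simp only [Set.mem_inter_iff, Set.mem_preimage, Set.mem_ofPred_eq, Set.mem_prod]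
    refine and_congr_right fun _ => ⟨fun hm k => ?_, fun hm => ⟨?_, ?_⟩⟩
    · split_ifs with hk hk'
      · rw [hk]; exact hm.1
      · rw [hk']; exact hm.2
      · trivial
    · simpa using hm ⟨i, hi⟩
    · simpa [hij.symm] using hm ⟨j, hj⟩
  · refine lintegral_congr fun ω => ?_
    rw [Finset.prod_eq_mul (⟨i, hi⟩ : Fin (max i j + 1)) ⟨j, hj⟩]
    · simp [hij.symm]
    · simpa using hij
    · intro k _ hk
      have h1 : (k : ℕ) ≠ i := fun hk' => hk.1 (Fin.ext hk')
      have h2 : (k : ℕ) ≠ j := fun hk' => hk.2 (Fin.ext hk')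
      simp [h1, h2]
    · simp
    · simp

theorem IsIndependentMarking.map_mark (h : X.IsIndependentMarking P κ) [IsMarkovKernel κ] (i : ℕ) :
    (P.restrict {ω | (i : ℕ∞) < X.N ω}).map (X.mark i) =
      ((P.restrict {ω | (i : ℕ∞) < X.N ω}).map (X.point i)).bind κ := by
  ext F hF
  rw [Measure.map_apply (X.measurable_mark i) hF, Measure.restrict_apply (X.measurable_mark i hF),
    Set.inter_comm, h.measure_mark_mem i hF, Measure.bind_apply hF κ.aemeasurable,
    lintegral_map (κ.measurable_coe hF) (X.measurable_point i)]

theorem IsIndependentMarking.map_mark_pair (h : X.IsIndependentMarking P κ) [IsMarkovKernel κ]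
    [IsFiniteMeasure P] {i j : ℕ} (hij : i ≠ j) :
    (P.restrict {ω | (i : ℕ∞) < X.N ω ∧ (j : ℕ∞) < X.N ω}).map
        (fun ω => (X.mark i ω, X.mark j ω)) =
      ((P.restrict {ω | (i : ℕ∞) < X.N ω ∧ (j : ℕ∞) < X.N ω}).map
        fun ω => (X.point i ω, X.point j ω)).bind (κ ∥ₖ κ) := by
  have hm : Measurable fun ω => (X.mark i ω, X.mark j ω) :=
    (X.measurable_mark i).prodMk (X.measurable_mark j)
  have hp : Measurable fun ω => (X.point i ω, X.point j ω) :=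
    (X.measurable_point i).prodMk (X.measurable_point j)
  refine Measure.ext_prod fun {F G} hF hG => ?_
  rw [Measure.map_apply hm (hF.prod hG), Measure.restrict_apply (hm (hF.prod hG)),
    Set.inter_comm, h.measure_mark_mem_pair hij hF hG,
    Measure.bind_apply (hF.prod hG) (κ ∥ₖ κ).aemeasurable,
    lintegral_map ((κ ∥ₖ κ).measurable_coe (hF.prod hG)) hp]
  simp only [Kernel.parallelComp_apply_prod]

/-- Campbell's formula for the superposition of the marks. -/
theorem IsIndependentMarking.lintegral_total (h : X.IsIndependentMarking P κ) [IsMarkovKernel κ]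
    {φ : Euc d × S → ℝ≥0∞} (hφ : Measurable φ) :
    ∫⁻ ω, ∫⁻ z, φ z ∂X.total ω ∂P =
      ∫⁻ u, ∫⁻ m, ∫⁻ z, φ z ∂m ∂κ u ∂X.pointIntensity P := by
  have hf : Measurable fun m : Measure (Euc d × S) => ∫⁻ z, φ z ∂m :=
    Measure.measurable_lintegral hφ
  have hterm : ∀ (i : ℕ) ω, ∫⁻ z, φ z ∂(if (i : ℕ∞) < X.N ω then X.mark i ω else 0) =
      {ω | (i : ℕ∞) < X.N ω}.indicator (fun ω => ∫⁻ z, φ z ∂X.mark i ω) ω := fun i ω => by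
    by_cases hi : (i : ℕ∞) < X.N ω <;> simp [hi]
  simp only [total, lintegral_sum_measure, hterm, pointIntensity]
  have hm : ∀ i, Measurable fun ω => ∫⁻ z, φ z ∂X.mark i ω := fun i =>
    hf.comp (X.measurable_mark i)
  rw [lintegral_tsum fun i => ((hm i).indicator (X.measurableSet_lt_N i)).aemeasurable]
  refine tsum_congr fun i => ?_
  rw [lintegral_indicator (X.measurableSet_lt_N i), ← lintegral_map hf (X.measurable_mark i),
    h.map_mark i, Measure.lintegral_bind κ.aemeasurable hf.aemeasurable]

/-- Campbell's formula for pairs of distinct marks. -/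
theorem IsIndependentMarking.lintegral_pairs (h : X.IsIndependentMarking P κ) [IsMarkovKernel κ]
    [IsFiniteMeasure P] {φ ψ : Euc d × S → ℝ≥0∞} (hφ : Measurable φ) (hψ : Measurable ψ) :
    ∫⁻ ω, ∫⁻ z, φ z.1 * ψ z.2 ∂X.pairs ω ∂P =
      ∫⁻ u, (∫⁻ m, ∫⁻ z, φ z ∂m ∂κ u.1) * (∫⁻ m, ∫⁻ z, ψ z ∂m ∂κ u.2) ∂X.pairIntensity P := by
  have hfin := X.finite_mark
  have hf : Measurable fun m : Measure (Euc d × S) => ∫⁻ z, φ z ∂m :=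
    Measure.measurable_lintegral hφ
  have hg : Measurable fun m : Measure (Euc d × S) => ∫⁻ z, ψ z ∂m :=
    Measure.measurable_lintegral hψ
  have hfg : Measurable fun m : Measure (Euc d × S) × Measure (Euc d × S) =>
      (∫⁻ z, φ z ∂m.1) * ∫⁻ z, ψ z ∂m.2 := (hf.comp measurable_fst).mul (hg.comp measurable_snd)
  have hm : ∀ i j, Measurable fun ω => (X.mark i ω, X.mark j ω) := fun i j =>
    (X.measurable_mark i).prodMk (X.measurable_mark j)
  have hterm : ∀ (p : ℕ × ℕ) ω, ∫⁻ z, φ z.1 * ψ z.2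
        ∂(if p.1 ≠ p.2 ∧ (p.1 : ℕ∞) < X.N ω ∧ (p.2 : ℕ∞) < X.N ω then
          (X.mark p.1 ω).prod (X.mark p.2 ω) else 0) =
      if p.1 ≠ p.2 then {ω | (p.1 : ℕ∞) < X.N ω ∧ (p.2 : ℕ∞) < X.N ω}.indicator
        (fun ω => (∫⁻ z, φ z ∂X.mark p.1 ω) * ∫⁻ z, ψ z ∂X.mark p.2 ω) ω else 0 := fun p ω => by
    by_cases hp : p.1 ≠ p.2
    · by_cases hi : (p.1 : ℕ∞) < X.N ω ∧ (p.2 : ℕ∞) < X.N ω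
      · rw [if_pos ⟨hp, hi⟩, if_pos hp, Set.indicator_of_mem (by exact hi),
          lintegral_prod_mul hφ.aemeasurable hψ.aemeasurable]
      · rw [if_neg fun h => hi h.2, if_pos hp, Set.indicator_of_notMem (by exact hi),
          lintegral_zero_measure]
    · rw [if_neg fun h => hp h.1, if_neg hp, lintegral_zero_measure]
  simp only [pairs, lintegral_sum_measure, hterm, pairIntensity]
  rw [lintegral_tsum]
  · refine tsum_congr fun ⟨i, j⟩ => ?_
    by_cases hij : i ≠ j
    · simp only [if_pos hij]
      rw [lintegral_indicator (X.measurableSet_lt_N_pair i j), ← lintegral_map hfg (hm i j),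
        h.map_mark_pair hij, Measure.lintegral_bind (κ ∥ₖ κ).aemeasurable hfg.aemeasurable]
      refine lintegral_congr fun u => ?_
      rw [Kernel.parallelComp_apply, lintegral_prod_mul hf.aemeasurable hg.aemeasurable]
    · simp [hij]
  · rintro ⟨i, j⟩
    by_cases hij : i ≠ j
    · simp only [if_pos hij]
      exact ((hfg.comp (hm i j)).indicator (X.measurableSet_lt_N_pair i j)).aemeasurable
    · simp [hij]

end Marking

/-! ### Moments of the marks under the null model -/

section NullModel

variable {X : MarkedProcess d S Ω} {P : Measure Ω} {ρY : Euc d → ℝ≥0}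
  {κ : Kernel (Euc d) (Measure (Euc d × S))} {ρ : Euc d × S → ℝ≥0} {ν : Measure S}

/-- Under the null model the second moments of distinct marks factorise. -/
theorem IsNullModel.lintegral_pairs (h : X.IsNullModel P ρY κ) [IsFiniteMeasure P]
    {φ ψ : Euc d × S → ℝ≥0∞} (hφ : Measurable φ) (hψ : Measurable ψ) :
    ∫⁻ ω, ∫⁻ z, φ z.1 * ψ z.2 ∂X.pairs ω ∂P =
      (∫⁻ ω, ∫⁻ z, φ z ∂X.total ω ∂P) * ∫⁻ ω, ∫⁻ z, ψ z ∂X.total ω ∂P := by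
  have := h.markov
  rw [h.marking.lintegral_pairs hφ hψ, h.marking.lintegral_total hφ, h.marking.lintegral_total hψ,
    pairIntensity_eq h.poisson, pointIntensity_eq h.poisson]
  have hκ : ∀ {χ : Euc d × S → ℝ≥0∞}, Measurable χ →
      Measurable fun u => ∫⁻ m, ∫⁻ z, χ z ∂m ∂κ u := fun hχ =>
    (Measure.measurable_lintegral (Measure.measurable_lintegral hχ)).comp κ.measurable
  exact lintegral_prod_mul (hκ hφ).aemeasurable (hκ hψ).aemeasurable

/-- Division by the density turns the first moment measure into the reference measure. -/
theorem HasDensity.firstReweighted_eq (h : X.HasDensity P ν ρ) [SFinite ν]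
    (hpos : ∀ᵐ z ∂((volume : Measure (Euc d)).prod ν), 0 < ρ z) :
    X.firstReweighted P ρ = (volume : Measure (Euc d)).prod ν := by
  have hρ : Measurable fun z => (ρ z : ℝ≥0∞) := h.measurable.coe_nnreal_ennreal
  ext C hC
  have hφ : Measurable (C.indicator fun z => (ρ z : ℝ≥0∞)⁻¹) := hρ.inv.indicator hC
  rw [X.firstReweighted_apply P h.measurable hC]
  simp only [← lintegral_indicator hC]
  rw [← Measure.lintegral_bind X.measurable_total.aemeasurable hφ.aemeasurable]
  have hm : P.bind X.total = _ := h.eq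
  rw [hm, lintegral_withDensity_eq_lintegral_mul _ hρ hφ, ← lintegral_indicator_one hC]
  refine lintegral_congr_ae (hpos.mono fun z hz => ?_)
  by_cases hzC : z ∈ C
  · simp [hzC, ENNReal.mul_inv_cancel (ENNReal.coe_ne_zero.2 hz.ne')]
  · simp [hzC]

theorem IsNullModel.secondReweighted_prod (h : X.IsNullModel P ρY κ) [IsFiniteMeasure P]
    (hρ : Measurable ρ) {C D : Set (Euc d × S)} (hC : MeasurableSet C) (hD : MeasurableSet D) :
    X.secondReweighted P ρ (C ×ˢ D) = X.firstReweighted P ρ C * X.firstReweighted P ρ D := by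
  have hinv : Measurable fun z => (ρ z : ℝ≥0∞)⁻¹ := hρ.coe_nnreal_ennreal.inv
  rw [X.secondReweighted_apply P hρ (hC.prod hD), X.firstReweighted_apply P hρ hC,
    X.firstReweighted_apply P hρ hD]
  simp only [← lintegral_indicator hC, ← lintegral_indicator hD,
    ← lintegral_indicator (hC.prod hD)]
  rw [← h.lintegral_pairs (hinv.indicator hC) (hinv.indicator hD)]
  refine lintegral_congr fun ω => lintegral_congr fun z => ?_
  by_cases h1 : z.1 ∈ C <;> by_cases h2 : z.2 ∈ D <;> simp [Set.indicator, h1, h2]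

theorem IsNullModel.secondReweighted_eq (h : X.IsNullModel P ρY κ) [IsFiniteMeasure P]
    (hd : X.HasDensity P ν ρ) [SigmaFinite ν]
    (hpos : ∀ᵐ z ∂((volume : Measure (Euc d)).prod ν), 0 < ρ z) :
    X.secondReweighted P ρ = (X.firstReweighted P ρ).prod (X.firstReweighted P ρ) := by
  have : SigmaFinite (X.firstReweighted P ρ) := by
    rw [hd.firstReweighted_eq hpos]; infer_instance
  exact (Measure.prod_eq fun C D hC hD => h.secondReweighted_prod hd.measurable hC hD).symm

end NullModel

end MarkedProcess

/-! ### The product measure: stationarity and close pairs -/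

section ProductMeasure

variable {d : ℕ} {S : Type*}

theorem isTranslationStationary_prod [MeasurableSpace S] (ν : Measure S) [SFinite ν] :
    IsTranslationStationary
      (((volume : Measure (Euc d)).prod ν).prod ((volume : Measure (Euc d)).prod ν)) := by
  intro h A B U T _ _ _ _
  simp [Measure.prod_prod, Set.image_add_right, measure_preimage_add_right]

/-- For a fixed first point `(x, s)` with `x ∈ W`, the close second points form the product of a
ball about `x` and a ball about `s`; the volume of the former does not depend on `x`. -/
theorem prod_closePairs [MetricSpace S] [SecondCountableTopology S] [MeasurableSpace S]
    [BorelSpace S] (ν : Measure S) [SFinite ν] {W : Set (Euc d)} (hW : MeasurableSet W)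
    (r₁ r₂ : ℝ) :
    (((volume : Measure (Euc d)).prod ν).prod ((volume : Measure (Euc d)).prod ν))
      (closePairs W r₁ r₂) = volume W * nullK d ν r₁ r₂ := by
  have hT : MeasurableSet {p : S × S | dist p.1 p.2 ≤ r₂} :=
    measurableSet_le (measurable_fst.dist measurable_snd) measurable_const
  have hC : MeasurableSet (closePairs (S := S) W r₁ r₂) :=
    (measurable_fst.fst hW).inter (MeasurableSet.inter
      (measurableSet_le (measurable_fst.fst.sub measurable_snd.fst).norm measurable_const)
      (measurableSet_le (measurable_fst.snd.dist measurable_snd.snd) measurable_const))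
  have hslice : ∀ z : Euc d × S,
      ((volume : Measure (Euc d)).prod ν) (Prod.mk z ⁻¹' closePairs W r₁ r₂) =
        W.indicator (fun _ => volume (Metric.closedBall (0 : Euc d) r₁)) z.1 *
          ν (Prod.mk z.2 ⁻¹' {p : S × S | dist p.1 p.2 ≤ r₂}) := fun z => by
    by_cases hz : z.1 ∈ W
    · rw [Set.indicator_of_mem hz, ← Measure.addHaar_closedBall_center volume z.1 r₁,
        ← Measure.prod_prod]
      congr 1
      ext y
      simp [closePairs, hz, dist_eq_norm, norm_sub_rev]
    · simp [closePairs, hz]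
  rw [Measure.prod_apply hC]
  simp only [hslice]
  rw [lintegral_prod_mul (measurable_const.indicator hW).aemeasurable
    (measurable_measure_prodMk_left hT).aemeasurable, lintegral_indicator_const hW, nullK,
    Measure.prod_apply hT, ← mul_assoc, mul_comm (volume W)]

end ProductMeasure

/-! ### Planar sectors in polar coordinates -/

section Polar

open Real

/-- The points of the open unit disc, without its centre, at an angle of at most `r` from the
first axis. -/
def planarSector (r : ℝ) : Set (ℝ × ℝ) :=
  {p | p ≠ 0 ∧ √(p.1 ^ 2 + p.2 ^ 2) < 1 ∧ arccos (p.1 / √(p.1 ^ 2 + p.2 ^ 2)) ≤ r}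

theorem measurableSet_planarSector (r : ℝ) : MeasurableSet (planarSector r) := by
  refine (measurableSet_singleton 0).compl.inter (MeasurableSet.inter ?_ ?_)
  · have : Measurable fun p : ℝ × ℝ => √(p.1 ^ 2 + p.2 ^ 2) := by fun_prop
    exact measurableSet_lt this measurable_const
  · have : Measurable fun p : ℝ × ℝ => p.1 / √(p.1 ^ 2 + p.2 ^ 2) := by fun_prop
    exact measurableSet_le (measurable_arccos.comp this) measurable_const

theorem sqrt_sq_mul_cos_add_sq_mul_sin {R : ℝ} (hR : 0 ≤ R) (θ : ℝ) :
    √((R * cos θ) ^ 2 + (R * sin θ) ^ 2) = R := by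
  rw [mul_pow, mul_pow, ← mul_add, cos_sq_add_sin_sq, mul_one, sqrt_sq hR]

theorem arccos_cos_eq_abs {θ : ℝ} (hθ : |θ| ≤ π) : arccos (cos θ) = |θ| := by
  rw [← cos_abs, arccos_cos (abs_nonneg θ) hθ]

theorem polarCoord_symm_mem_planarSector {p : ℝ × ℝ} (hp : p ∈ polarCoord.target) (r : ℝ) :
    polarCoord.symm p ∈ planarSector r ↔ p ∈ Set.Iio 1 ×ˢ Set.Icc (-r) r := by
  rw [polarCoord_target] at hp
  have hR : 0 < p.1 := hp.1
  have hθ : |p.2| ≤ π := abs_le.2 ⟨hp.2.1.le, hp.2.2.le⟩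
  have hs := sqrt_sq_mul_cos_add_sq_mul_sin hR.le p.2
  have h0 : (p.1 * cos p.2, p.1 * sin p.2) ≠ (0 : ℝ × ℝ) := fun h => by
    have h1 : p.1 * cos p.2 = 0 := congrArg Prod.fst h
    have h2 : p.1 * sin p.2 = 0 := congrArg Prod.snd h
    rw [h1, h2] at hs
    simp at hs
    exact hR.ne hs
  simp only [planarSector, polarCoord_symm_apply, Set.mem_ofPred_eq, hs, mul_div_cancel_left₀ _ hR.ne',
    arccos_cos_eq_abs hθ, Set.mem_prod, Set.mem_Iio, Set.mem_Icc, ← abs_le]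
  exact and_iff_right h0

/-- Polar coordinates on a planar sector. The excluded ray `θ = π` matters only for `r = π`, and is
negligible. -/
theorem setLIntegral_planarSector {r : ℝ} (hr : r ≤ π) (h : ℝ × ℝ → ℝ≥0∞) :
    ∫⁻ p in planarSector r, h p =
      ∫⁻ p in Set.Ioo 0 1 ×ˢ Set.Icc (-r) r,
        ENNReal.ofReal p.1 * h (p.1 * cos p.2, p.1 * sin p.2) := by
  have hB : MeasurableSet (Set.Iio (1 : ℝ) ×ˢ Set.Icc (-r) r) := measurableSet_Iio.prod
    measurableSet_Icc
  have hsets : ((Set.Iio (1 : ℝ) ×ˢ Set.Icc (-r) r) ∩ polarCoord.target : Set (ℝ × ℝ)) =ᵐ[volume]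
      (Set.Ioo (0 : ℝ) 1 ×ˢ Set.Icc (-r) r : Set (ℝ × ℝ)) := by
    have h1 : (Set.Iio (1 : ℝ) ×ˢ Set.Icc (-r) r) ∩ polarCoord.target =
        Set.Ioo (0 : ℝ) 1 ×ˢ (Set.Icc (-r) r ∩ Set.Ioo (-π) π) := by
      rw [polarCoord_target, Set.prod_inter_prod, Set.inter_comm (Set.Iio 1), Set.Ioi_inter_Iio]
    have h2 : Set.Icc (-r) r = Set.Icc (-r) r ∩ Set.Icc (-π) π :=
      (Set.inter_eq_left.2 (Set.Icc_subset_Icc (neg_le_neg hr) hr)).symm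
    rw [h1]
    refine Measure.set_prod_ae_eq (ae_eq_refl _) ?_
    conv_rhs => rw [h2]
    exact ae_eq_set_inter (ae_eq_refl _) Ioo_ae_eq_Icc
  rw [← lintegral_indicator (measurableSet_planarSector r), ← lintegral_comp_polarCoord_symm,
    ← setLIntegral_congr hsets, ← setLIntegral_indicator hB]
  refine setLIntegral_congr_fun polarCoord.open_target.measurableSet fun p hp => ?_
  by_cases hpB : p ∈ Set.Iio (1 : ℝ) ×ˢ Set.Icc (-r) r
  · rw [Set.indicator_of_mem hpB,
      Set.indicator_of_mem ((polarCoord_symm_mem_planarSector hp r).2 hpB), smul_eq_mul,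
      polarCoord_symm_apply]
  · rw [Set.indicator_of_notMem hpB, Set.indicator_of_notMem
      (fun h' => hpB ((polarCoord_symm_mem_planarSector hp r).1 h')), smul_zero]

/-- Integration of a radial function on the plane; the factor `ENNReal.ofReal R` vanishes for
`R ≤ 0`, so the right-hand side is an integral over `R > 0`. -/
theorem lintegral_comp_sqrt_sq_add_sq {g : ℝ → ℝ≥0∞} (hg : Measurable g) :
    ∫⁻ p : ℝ × ℝ, g √(p.1 ^ 2 + p.2 ^ 2) =
      ENNReal.ofReal (2 * π) * ∫⁻ R : ℝ, ENNReal.ofReal R * g R := by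
  have hsub : ∫⁻ R : ℝ, ENNReal.ofReal R * g R = ∫⁻ R in Set.Ioi 0, ENNReal.ofReal R * g R := by
    rw [← lintegral_indicator measurableSet_Ioi]
    refine lintegral_congr fun R => ?_
    by_cases hR : 0 < R
    · rw [Set.indicator_of_mem (Set.mem_Ioi.2 hR)]
    · rw [Set.indicator_of_notMem (by simpa using hR), ENNReal.ofReal_of_nonpos (not_lt.1 hR),
        zero_mul]
  rw [← lintegral_comp_polarCoord_symm, hsub]
  have hcongr : ∫⁻ p in polarCoord.target, ENNReal.ofReal p.1 •
        g √((polarCoord.symm p).1 ^ 2 + (polarCoord.symm p).2 ^ 2) =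
      ∫⁻ p in Set.Ioi (0 : ℝ) ×ˢ Set.Ioo (-π) π, (ENNReal.ofReal p.1 * g p.1) * 1 := by
    refine setLIntegral_congr_fun polarCoord.open_target.measurableSet fun p hp => ?_
    rw [polarCoord_target] at hp
    simp only [polarCoord_symm_apply, sqrt_sq_mul_cos_add_sq_mul_sin (le_of_lt hp.1), smul_eq_mul,
      mul_one]
  rw [hcongr, Measure.volume_eq_prod, ← Measure.prod_restrict,
    lintegral_prod_mul (f := fun R => ENNReal.ofReal R * g R) (g := fun _ => 1)
      (by fun_prop) (by fun_prop), lintegral_one, Measure.restrict_apply_univ, Real.volume_Ioo,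
    mul_comm]
  congr 2
  ring

theorem setLIntegral_Ioo_zero_one_ofReal_pow (n : ℕ) :
    ∫⁻ R in Set.Ioo (0 : ℝ) 1, ENNReal.ofReal (R ^ n) = ENNReal.ofReal (1 / (n + 1)) := by
  rw [setLIntegral_congr Ioo_ae_eq_Ioc, ← ofReal_integral_eq_lintegral_ofReal,
    ← intervalIntegral.integral_of_le zero_le_one, integral_pow]
  · simp
  · exact (continuous_pow n).integrableOn_Ioc
  · exact (ae_restrict_mem measurableSet_Ioc).mono fun R hR => pow_nonneg hR.1.le n

theorem volume_planarSector {r : ℝ} (hr : r ≤ π) :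
    volume (planarSector r) = ENNReal.ofReal r := by
  rw [← setLIntegral_one, setLIntegral_planarSector hr, Measure.volume_eq_prod,
    ← Measure.prod_restrict, lintegral_prod_mul (f := fun R => ENNReal.ofReal R) (g := fun _ => 1)
      (by fun_prop) (by fun_prop), lintegral_one, Measure.restrict_apply_univ, Real.volume_Icc]
  have := setLIntegral_Ioo_zero_one_ofReal_pow 1
  simp only [pow_one] at this
  rw [this, ← ENNReal.ofReal_mul (by positivity)]
  congr 1
  push_cast
  ring

/-- The truncation `ENNReal.ofReal` removes the half `[-r, 0]`, where `sin` is nonpositive. -/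
theorem setLIntegral_Icc_ofReal_sin {r : ℝ} (hr₀ : 0 ≤ r) (hr : r ≤ π) :
    ∫⁻ θ in Set.Icc (-r) r, ENNReal.ofReal (sin θ) = ENNReal.ofReal (1 - cos r) := by
  have hneg : ∫⁻ θ in Set.Icc (-r) 0, ENNReal.ofReal (sin θ) = 0 := by
    rw [setLIntegral_congr_fun (g := fun _ => 0) measurableSet_Icc, lintegral_zero]
    intro θ hθ
    exact ENNReal.ofReal_of_nonpos (sin_nonpos_of_nonpos_of_neg_pi_le hθ.2 (by linarith [hθ.1]))
  rw [← Set.Icc_union_Ioc_eq_Icc (neg_nonpos.2 hr₀) hr₀,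
    lintegral_union measurableSet_Ioc (Set.disjoint_left.2 fun x hx hx' => not_lt.2 hx.2 hx'.1),
    hneg, zero_add, ← ofReal_integral_eq_lintegral_ofReal,
    ← intervalIntegral.integral_of_le hr₀, integral_sin, cos_zero]
  · exact continuous_sin.integrableOn_Ioc
  · exact (ae_restrict_mem measurableSet_Ioc).mono fun θ hθ =>
      sin_nonneg_of_nonneg_of_le_pi hθ.1.le (hθ.2.trans hr)

/-- The integral, over the upper half of the sector, of the distance to its axis. -/
theorem setLIntegral_planarSector_ofReal_snd {r : ℝ} (hr₀ : 0 ≤ r) (hr : r ≤ π) :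
    ∫⁻ p in planarSector r, ENNReal.ofReal p.2 = ENNReal.ofReal ((1 - cos r) / 3) := by
  rw [setLIntegral_planarSector hr]
  have hcongr : ∫⁻ p in Set.Ioo (0 : ℝ) 1 ×ˢ Set.Icc (-r) r,
        ENNReal.ofReal p.1 * ENNReal.ofReal (p.1 * sin p.2) =
      ∫⁻ p in Set.Ioo (0 : ℝ) 1 ×ˢ Set.Icc (-r) r,
        ENNReal.ofReal (p.1 ^ 2) * ENNReal.ofReal (sin p.2) := by
    refine setLIntegral_congr_fun (measurableSet_Ioo.prod measurableSet_Icc) fun p hp => ?_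
    have h0 : 0 ≤ p.1 := hp.1.1.le
    rw [ENNReal.ofReal_mul h0, ← mul_assoc, ← ENNReal.ofReal_mul h0, sq]
  rw [hcongr, Measure.volume_eq_prod, ← Measure.prod_restrict,
    lintegral_prod_mul (f := fun R => ENNReal.ofReal (R ^ 2))
      (g := fun θ => ENNReal.ofReal (sin θ)) (by fun_prop) (by fun_prop),
    setLIntegral_Ioo_zero_one_ofReal_pow, setLIntegral_Icc_ofReal_sin hr₀ hr,
    ← ENNReal.ofReal_mul (by positivity)]
  congr 1
  push_cast
  ring

end Polar

/-! ### Sectors of the unit ball -/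

section Sector

open InnerProductGeometry

variable {d : ℕ}

/-- The points of the open unit ball, without its centre, at an angle of at most `r` from `t`. -/
def ballSector (t : Euc d) (r : ℝ) : Set (Euc d) :=
  {x | x ≠ 0 ∧ ‖x‖ < 1 ∧ angle t x ≤ r}

/-- The volume of a sector does not depend on its axis: a reflection exchanges two axes. -/
theorem volume_ballSector_eq {t t' : Euc d} (h : ‖t‖ = ‖t'‖) (r : ℝ) :
    volume (ballSector t r) = volume (ballSector t' r) := by
  let L : Euc d ≃ₗᵢ[ℝ] Euc d := Submodule.reflection (Submodule.span ℝ {t - t'})ᗮ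
  have hL : L t = t' := Submodule.reflection_sub h
  have hpre : ballSector t r = L ⁻¹' ballSector t' r := by
    ext x
    have hangle : angle t' (L x) = angle t x := by
      rw [← hL]; exact L.toLinearIsometry.angle_map t x
    simp [ballSector, hangle]
  rw [hpre]
  exact L.measurePreserving.measure_preimage_equiv (f := L.toMeasurableEquiv) _

open scoped Pointwise in
/-- The cone that `MeasureTheory.Measure.toSphere` assigns to an angular ball. -/
theorem smul_image_eq_ballSector (t : Euc d) (r : ℝ) :
    Set.Ioo (0 : ℝ) 1 • (Subtype.val '' {s : Metric.sphere (0 : Euc d) 1 | angle t (s : Euc d) ≤ r})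
      = ballSector t r := by
  ext x
  rw [Set.mem_smul]
  constructor
  · rintro ⟨c, hc, _, ⟨s, hs, rfl⟩, rfl⟩
    have hn : ‖(s : Euc d)‖ = 1 := by simp
    refine ⟨smul_ne_zero hc.1.ne' (fun h0 => by simp [h0] at hn), ?_, ?_⟩
    · rw [norm_smul, hn, mul_one, Real.norm_of_nonneg hc.1.le]
      exact hc.2
    · rw [angle_smul_right_of_pos _ _ hc.1]
      exact hs
  · rintro ⟨h0, h1, hr⟩
    have hpos : 0 < ‖x‖ := norm_pos_iff.2 h0
    refine ⟨‖x‖, ⟨hpos, h1⟩, ‖x‖⁻¹ • x, ⟨⟨‖x‖⁻¹ • x, ?_⟩, ?_, rfl⟩, ?_⟩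
    · simp [norm_smul, hpos.ne']
    · simpa [angle_smul_right_of_pos _ _ (inv_pos.2 hpos)] using hr
    · rw [smul_smul, mul_inv_cancel₀ hpos.ne', one_smul]

theorem angle_single_zero {n : ℕ} (x : Euc (n + 1)) :
    angle (EuclideanSpace.single 0 1 : Euc (n + 1)) x = Real.arccos (x 0 / ‖x‖) := by
  simp [angle, EuclideanSpace.inner_single_left]

theorem volume_ballSector_two {r : ℝ} (hr : r ≤ Real.pi) :
    volume (ballSector (EuclideanSpace.single 0 1 : Euc 2) r) = ENNReal.ofReal r := by
  have hmp := (volume_preserving_finTwoArrow ℝ).comp (PiLp.volume_preserving_ofLp (Fin 2))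
  rw [← volume_planarSector hr,
    ← hmp.measure_preimage (measurableSet_planarSector r).nullMeasurableSet]
  congr 1
  ext x
  have h0 : x = 0 ↔ x 0 = 0 ∧ x 1 = 0 := by
    rw [← Fin.forall_fin_two (p := fun i => x i = 0)]
    exact ⟨fun h => by simp [h], fun h => by ext i; exact h i⟩
  simp only [ballSector, planarSector, angle_single_zero, EuclideanSpace.norm_eq,
    Fin.sum_univ_two, Real.norm_eq_abs, sq_abs, Set.mem_ofPred_eq, Set.mem_preimage, ne_eq, h0]
  simp [Prod.ext_iff]

/-- The sector consists of the points whose cylindrical coordinates (height, distance to the axis)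
lie in the planar sector. -/
theorem volume_ballSector_three {r : ℝ} (hr₀ : 0 ≤ r) (hr : r ≤ Real.pi) :
    volume (ballSector (EuclideanSpace.single 0 1 : Euc 3) r) =
      ENNReal.ofReal (2 * Real.pi * ((1 - Real.cos r) / 3)) := by
  let G : Euc 3 → ℝ × (ℝ × ℝ) := fun x => (x 0, (x 1, x 2))
  have hG : MeasurePreserving G volume volume :=
    (((MeasurePreserving.id (volume : Measure ℝ)).prod
      (volume_preserving_finTwoArrow ℝ)).comp
        (volume_preserving_piFinSuccAbove (fun _ : Fin 3 => ℝ) 0)).comp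
          (PiLp.volume_preserving_ofLp (Fin 3))
  let F : ℝ × (ℝ × ℝ) → ℝ × ℝ := fun q => (q.1, √(q.2.1 ^ 2 + q.2.2 ^ 2))
  have hF : Measurable F := by fun_prop
  have hQ := measurableSet_planarSector r
  have hpre : ballSector (EuclideanSpace.single 0 1 : Euc 3) r = G ⁻¹' (F ⁻¹' planarSector r) := by
    ext x
    have h0 : x = 0 ↔ (x 0, √(x 1 ^ 2 + x 2 ^ 2)) = (0 : ℝ × ℝ) := by
      rw [Prod.ext_iff]
      constructor
      · rintro rfl
        simp
      · rintro ⟨hx0, hx⟩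
        have hx' : x 1 ^ 2 + x 2 ^ 2 ≤ 0 := Real.sqrt_eq_zero'.1 hx
        have h1 : x 1 = 0 := by nlinarith [sq_nonneg (x 1), sq_nonneg (x 2)]
        have h2 : x 2 = 0 := by nlinarith [sq_nonneg (x 1), sq_nonneg (x 2)]
        ext i
        fin_cases i
        exacts [hx0, h1, h2]
    have hs : √(x 1 ^ 2 + x 2 ^ 2) ^ 2 = x 1 ^ 2 + x 2 ^ 2 := Real.sq_sqrt (by positivity)
    simp only [ballSector, planarSector, angle_single_zero, EuclideanSpace.norm_eq,
      Fin.sum_univ_three, Real.norm_eq_abs, sq_abs, Set.mem_ofPred_eq, Set.mem_preimage, ne_eq, h0,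
      F, G, hs, add_assoc]
  have h1 : Measurable ((planarSector r).indicator (1 : ℝ × ℝ → ℝ≥0∞)) :=
    measurable_one.indicator hQ
  rw [hpre, hG.measure_preimage (hF hQ).nullMeasurableSet, ← lintegral_indicator_one (hF hQ),
    Measure.volume_eq_prod, lintegral_prod _ (measurable_one.indicator (hF hQ)).aemeasurable]
  have hinner : ∀ a : ℝ, ∫⁻ p : ℝ × ℝ, (F ⁻¹' planarSector r).indicator 1 (a, p) =
      ENNReal.ofReal (2 * Real.pi) *
        ∫⁻ R : ℝ, ENNReal.ofReal R * (planarSector r).indicator 1 (a, R) := fun a =>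
    lintegral_comp_sqrt_sq_add_sq (g := fun R => (planarSector r).indicator 1 (a, R))
      (h1.comp measurable_prodMk_left)
  have hm : Measurable fun p : ℝ × ℝ =>
      ENNReal.ofReal p.2 * (planarSector r).indicator (1 : ℝ × ℝ → ℝ≥0∞) p :=
    (by fun_prop : Measurable fun p : ℝ × ℝ => ENNReal.ofReal p.2).mul h1
  simp only [hinner]
  rw [lintegral_const_mul _ hm.lintegral_prod_right', ← lintegral_prod _ hm.aemeasurable,
    ENNReal.ofReal_mul (by positivity : 0 ≤ 2 * Real.pi), ← setLIntegral_planarSector_ofReal_snd hr₀ hr,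
    ← lintegral_indicator hQ]
  congr 1
  refine lintegral_congr fun p => ?_
  by_cases hp : p ∈ planarSector r <;> simp [hp]

end Sector

/-! ### Uniform measure on the sphere and the values of `K₀` -/

namespace Direction

variable {d : ℕ}

theorem toSphere_univ_ne_zero (hd : d ≠ 0) :
    (volume : Measure (Euc d)).toSphere Set.univ ≠ 0 := by
  rw [Measure.measure_univ_ne_zero, Ne, Measure.toSphere_eq_zero_iff_finrank]
  simpa using hd

theorem isProbabilityMeasure_uniform (hd : d ≠ 0) : IsProbabilityMeasure (uniform d) := by
  constructor
  rw [uniform, Measure.smul_apply, Measure.map_apply continuous_mk.measurable .univ,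
    Set.preimage_univ, smul_eq_mul,
    ENNReal.inv_mul_cancel (toSphere_univ_ne_zero hd) (measure_ne_top _ _)]

theorem uniform_closedBall (hd : d ≠ 0) (t : Direction d) (r : ℝ) :
    uniform d {s | dist t s ≤ r} =
      (volume (Metric.ball (0 : Euc d) 1))⁻¹ * volume (ballSector (t.vec : Euc d) r) := by
  have hm : MeasurableSet {s : Direction d | dist t s ≤ r} :=
    measurableSet_le (continuous_const.dist continuous_id).measurable measurable_const
  have hpre : Direction.mk ⁻¹' {s : Direction d | dist t s ≤ r} =
      {s : Metric.sphere (0 : Euc d) 1 |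
        InnerProductGeometry.angle (t.vec : Euc d) (s : Euc d) ≤ r} := by
    ext s
    simp only [Set.mem_preimage, Set.mem_ofPred_eq, dist_def, angle_eq]
  have hms := continuous_mk.measurable hm
  rw [uniform, Measure.smul_apply, Measure.map_apply continuous_mk.measurable hm,
    Measure.toSphere_apply' _ hms, hpre, smul_image_eq_ballSector, Measure.toSphere_apply_univ,
    smul_eq_mul, finrank_euclideanSpace, Fintype.card_fin]
  have hd' : (d : ℝ≥0∞) ≠ 0 := by exact_mod_cast hd
  rw [ENNReal.mul_inv (.inl hd') (.inl (ENNReal.natCast_ne_top d)), mul_mul_mul_comm,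
    ENNReal.inv_mul_cancel hd' (ENNReal.natCast_ne_top d), one_mul]

theorem uniform_prod_dist_le {n : ℕ} (r : ℝ) :
    ((uniform (n + 1)).prod (uniform (n + 1)))
        {p : Direction (n + 1) × Direction (n + 1) | dist p.1 p.2 ≤ r} =
      (volume (Metric.ball (0 : Euc (n + 1)) 1))⁻¹ *
        volume (ballSector (EuclideanSpace.single 0 1 : Euc (n + 1)) r) := by
  have := isProbabilityMeasure_uniform (d := n + 1) n.succ_ne_zero
  rw [Measure.prod_apply (measurableSet_le (measurable_fst.dist measurable_snd) measurable_const)]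
  have hslice : ∀ t : Direction (n + 1), uniform (n + 1)
      (Prod.mk t ⁻¹' {p : Direction (n + 1) × Direction (n + 1) | dist p.1 p.2 ≤ r}) =
      (volume (Metric.ball (0 : Euc (n + 1)) 1))⁻¹ *
        volume (ballSector (EuclideanSpace.single 0 1 : Euc (n + 1)) r) := fun t => by
    rw [volume_ballSector_eq (t' := (t.vec : Euc (n + 1))) (by simp) r,
      ← uniform_closedBall n.succ_ne_zero]
    rfl
  simp only [hslice, lintegral_const, measure_univ, mul_one]

end Direction

theorem nullK_two {r₁ r₂ : ℝ} (h₁ : 0 ≤ r₁) (h₂' : r₂ ≤ Real.pi) :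
    nullK 2 (Direction.uniform 2) r₁ r₂ = ENNReal.ofReal (r₁ ^ 2 * r₂) := by
  rw [nullK, Direction.uniform_prod_dist_le, volume_ballSector_two h₂',
    EuclideanSpace.volume_closedBall_fin_two, EuclideanSpace.volume_ball_fin_two,
    ENNReal.ofReal_one, one_pow, one_mul, ← ENNReal.ofReal_inv_of_pos Real.pi_pos,
    ← ENNReal.ofReal_pow h₁, ← ENNReal.ofReal_mul (by positivity),
    ← ENNReal.ofReal_mul (by positivity), ← ENNReal.ofReal_mul (by positivity)]
  congr 1
  field_simp

theorem nullK_three {r₁ r₂ : ℝ} (h₁ : 0 ≤ r₁) (h₂ : 0 ≤ r₂) (h₂' : r₂ ≤ Real.pi) :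
    nullK 3 (Direction.uniform 3) r₁ r₂ =
      ENNReal.ofReal (2 * Real.pi / 3 * r₁ ^ 3 * (1 - Real.cos r₂)) := by
  rw [nullK, Direction.uniform_prod_dist_le, volume_ballSector_three h₂ h₂',
    EuclideanSpace.volume_closedBall_fin_three, EuclideanSpace.volume_ball_fin_three,
    ENNReal.ofReal_one, one_pow, one_mul, ← ENNReal.ofReal_inv_of_pos (by positivity),
    ← ENNReal.ofReal_pow h₁, ← ENNReal.ofReal_mul (by positivity),
    ← ENNReal.ofReal_mul (by positivity), ← ENNReal.ofReal_mul (by positivity)]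
  congr 1
  field_simp

/-! ### The reweighted `K`-function under the null model -/

/-- Under the null model `K_w` does not depend on the window, whose volume cancels. -/
theorem MarkedProcess.IsNullModel.reweightedK_eq_nullK {d : ℕ} {S Ω : Type*} [MetricSpace S]
    [SecondCountableTopology S] [MeasurableSpace S] [BorelSpace S] [MeasurableSpace Ω]
    {ν : Measure S} [SigmaFinite ν] {P : Measure Ω} [IsFiniteMeasure P] {X : MarkedProcess d S Ω}
    {ρY : Euc d → ℝ≥0} {κ : Kernel (Euc d) (Measure (Euc d × S))} {ρ : Euc d × S → ℝ≥0}
    (hX : X.IsNullModel P ρY κ) (hd : X.HasDensity P ν ρ)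
    (hpos : ∀ᵐ z ∂((volume : Measure (Euc d)).prod ν), 0 < ρ z) {W : Set (Euc d)}
    (hW : MeasurableSet W) (hW₀ : 0 < volume W) (hW₁ : volume W < ∞) (r₁ r₂ : ℝ) :
    X.reweightedK P ρ r₁ r₂ W = nullK d ν r₁ r₂ := by
  rw [X.reweightedK_eq P hd.measurable r₁ r₂ hW, hX.secondReweighted_eq hd hpos,
    hd.firstReweighted_eq hpos, prod_closePairs ν hW, ← mul_assoc,
    ENNReal.inv_mul_cancel hW₀.ne' hW₁.ne, one_mul]

theorem proposition1 :
    (∀ (d : ℕ) (_ : 1 ≤ d) (S : Type*) [MetricSpace S] [SecondCountableTopology S]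
      [MeasurableSpace S] [BorelSpace S] (ν : Measure S) [SigmaFinite ν]
      (Ω : Type*) [MeasurableSpace Ω] (P : Measure Ω) [IsProbabilityMeasure P]
      (X : MarkedProcess d S Ω) (ρY : Euc d → ℝ≥0) (κ : Kernel (Euc d) (Measure (Euc d × S)))
      (ρ : Euc d × S → ℝ≥0),
      X.IsNullModel P ρY κ → X.HasDensity P ν ρ →
      (∀ᵐ z ∂((volume : Measure (Euc d)).prod ν), 0 < ρ z) →
      X.secondReweighted P ρ = (X.firstReweighted P ρ).prod (X.firstReweighted P ρ) ∧
      IsTranslationStationary (X.secondReweighted P ρ) ∧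
      ∀ W : Set (Euc d), MeasurableSet W → 0 < volume W → volume W < ∞ →
        ∀ r₁ r₂ : ℝ, 0 ≤ r₁ → 0 ≤ r₂ → X.reweightedK P ρ r₁ r₂ W = nullK d ν r₁ r₂) ∧
    (∀ r₁ r₂ : ℝ, 0 ≤ r₁ → 0 ≤ r₂ → r₂ ≤ Real.pi →
      nullK 2 (Direction.uniform 2) r₁ r₂ = ENNReal.ofReal (r₁ ^ 2 * r₂) ∧
      nullK 3 (Direction.uniform 3) r₁ r₂ =
        ENNReal.ofReal (2 * Real.pi / 3 * r₁ ^ 3 * (1 - Real.cos r₂))) ∧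
    (∀ (Ω : Type*) [MeasurableSpace Ω] (P : Measure Ω) [IsProbabilityMeasure P]
      (X : MarkedProcess 2 (Direction 2) Ω) (ρY : Euc 2 → ℝ≥0)
      (κ : Kernel (Euc 2) (Measure (Euc 2 × Direction 2))) (ρ : Euc 2 × Direction 2 → ℝ≥0),
      X.HasOrientedFibreMarks P → X.IsNullModel P ρY κ →
      X.HasDensity P (Direction.uniform 2) ρ →
      (∀ᵐ z ∂((volume : Measure (Euc 2)).prod (Direction.uniform 2)), 0 < ρ z) →
      ∀ W : Set (Euc 2), MeasurableSet W → 0 < volume W → volume W < ∞ →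
        ∀ r₁ r₂ : ℝ, 0 ≤ r₁ → 0 ≤ r₂ → r₂ ≤ Real.pi →
          X.reweightedK P ρ r₁ r₂ W = ENNReal.ofReal (r₁ ^ 2 * r₂)) ∧
    (∀ (Ω : Type*) [MeasurableSpace Ω] (P : Measure Ω) [IsProbabilityMeasure P]
      (X : MarkedProcess 3 (Direction 3) Ω) (ρY : Euc 3 → ℝ≥0)
      (κ : Kernel (Euc 3) (Measure (Euc 3 × Direction 3))) (ρ : Euc 3 × Direction 3 → ℝ≥0),
      X.HasOrientedFibreMarks P → X.IsNullModel P ρY κ →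
      X.HasDensity P (Direction.uniform 3) ρ →
      (∀ᵐ z ∂((volume : Measure (Euc 3)).prod (Direction.uniform 3)), 0 < ρ z) →
      ∀ W : Set (Euc 3), MeasurableSet W → 0 < volume W → volume W < ∞ →
        ∀ r₁ r₂ : ℝ, 0 ≤ r₁ → 0 ≤ r₂ → r₂ ≤ Real.pi →
          X.reweightedK P ρ r₁ r₂ W =
            ENNReal.ofReal (2 * Real.pi / 3 * r₁ ^ 3 * (1 - Real.cos r₂))) := by
  refine ⟨?_, fun r₁ r₂ h₁ h₂ h₂' => ⟨nullK_two h₁ h₂', nullK_three h₁ h₂ h₂'⟩, ?_, ?_⟩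
  · intro d _ S _ _ _ _ ν _ Ω _ P _ X ρY κ ρ hX hd hpos
    refine ⟨hX.secondReweighted_eq hd hpos, ?_, fun W hW hW₀ hW₁ r₁ r₂ _ _ =>
      hX.reweightedK_eq_nullK hd hpos hW hW₀ hW₁ r₁ r₂⟩
    rw [hX.secondReweighted_eq hd hpos, hd.firstReweighted_eq hpos]
    exact isTranslationStationary_prod ν
  · intro Ω _ P _ X ρY κ ρ _ hX hd hpos W hW hW₀ hW₁ r₁ r₂ h₁ _ h₂'
    have := Direction.isProbabilityMeasure_uniform (d := 2) two_ne_zero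
    rw [hX.reweightedK_eq_nullK hd hpos hW hW₀ hW₁, nullK_two h₁ h₂']
  · intro Ω _ P _ X ρY κ ρ _ hX hd hpos W hW hW₀ hW₁ r₁ r₂ h₁ h₂ h₂'
    have := Direction.isProbabilityMeasure_uniform (d := 3) three_ne_zero
    rw [hX.reweightedK_eq_nullK hd hpos hW hW₀ hW₁, nullK_three h₁ h₂ h₂']
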